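/- Two players, Row and Column, each have the three pure strategies $1,2,J$. In all four games below Column's payoff matrix (rows: Row's strategy, columns: Column's strategy, in the order $1,2,J$) is $$\begin{pmatrix}30&10&30\\10&30&30\\30&30&10\end{pmatrix},$$ and Row's payoff matrices in Games 1, 2, 3, 4 are respectively $$\begin{pmatrix}10&30&10\\30&10&10\\10&10&30\end{pmatrix},\quad\begin{pmatrix}10&30&10\\30&10&10\\10&10&55\end{pmatrix},\quad\begin{pmatrix}25&30&10\\30&25&10\\10&10&30\end{pmatrix},\quad\begin{pmatrix}20&30&10\\30&10&10\\10&10&30\end{pmatrix}.$$ A quantal response function is a map $\pi:\mathbb R^3\to\Delta$ from vectors of expected payoffs of the three pure strategies to the simplex $\Delta$ of mixed strategies. It is regular if it satisfies Interiority ($\pi_j(u)>0$ for all $j,u$), Continuity ($\pi$ is continuous), Responsiveness ($\pi_j(u)$ is strictly increasing in $u_j$, the other payoffs being fixed) and Rank-order ($u_j>u_k\Rightarrow\pi_j(u)>\pi_k(u)$). It is structural if there is an absolutely continuous probability distribution $F$ on $\mathbb R^3$ with mean zero, not depending on $u$, such that $\pi_j(u)=F\{\varepsilon: u_j+\varepsilon_j\ge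 u_k+\varepsilon_k\ \forall k\}$ for all $u$ and $j$. Given quantal response functions $\pi_R,\pi_C$, a quantal response equilibrium (QRE) of a game is a pair of mixed strategies $(\sigma^R,\sigma^C)$ with $\sigma^R=\pi_R(u_R(\sigma^C))$ and $\sigma^C=\pi_C(u_C(\sigma^R))$, where $u_R(\sigma^C)$ and $u_C(\sigma^R)$ are the vectors of expected payoffs of Row's and of Column's pure strategies. Let $\pi_R,\pi_C$ be regular quantal response functions. Then each of Games 1--4 has a QRE, and if $\pi_R$ and $\pi_C$ are moreover structural, then each of Games 1--4 has exactly one QRE. In Game 1, whether or not $\pi_R,\pi_C$ are structural, the unique QRE is $\sigma^R=\sigma^C=(\frac13,\frac13,\frac13)$. Again whether or not $\pi_R,\pi_C$ are structural, every QRE satisfies: in Game 2, $\sigma^R_1=\sigma^R_2\in(0,\frac13)$ and $\sigma^C_1=\sigma^C_2\in(\frac13,\frac9{22}]$; in Game 3, $\sigma^R_1=\sigma^R_2\in(\frac13,1)$ and $\sigma^C_1=\sigma^C_2\in[\frac4{15},\frac13)$; in Game 4, $\sigma^R_2=\sigma^R_J\in(0,\frac13)$ and $\sigma^C_1=\sigma^C_J\in(\frac13,\frac25]$.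 -/

import Mathlib

open MeasureTheory Set

/-- A two-player game in strategic form: Row chooses in `ι`, Column chooses in `κ`, and `row i j`,
`col i j` are the payoffs of Row and of Column when Row plays `i` and Column plays `j`. -/
structure BimatrixGame (ι κ : Type*) where
  row : Matrix ι κ ℝ
  col : Matrix ι κ ℝ

namespace BimatrixGame

variable {ι κ : Type*} [Fintype ι] [Fintype κ]

/-- Expected payoffs of Row's pure strategies when Column plays the mixed strategy `τ`. -/
def rowExpected (G : BimatrixGame ι κ) (τ : stdSimplex ℝ κ) : ι → ℝ :=
  fun i => ∑ j, τ.1 j * G.row i j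

/-- Expected payoffs of Column's pure strategies when Row plays the mixed strategy `σ`. -/
def colExpected (G : BimatrixGame ι κ) (σ : stdSimplex ℝ ι) : κ → ℝ :=
  fun j => ∑ i, σ.1 i * G.col i j

/-- `σ = (σ.1, σ.2)` is a quantal response equilibrium of `G` with respect to the quantal response
functions `πR` of Row and `πC` of Column. -/
def IsQRE (G : BimatrixGame ι κ) (πR : (ι → ℝ) → stdSimplex ℝ ι) (πC : (κ → ℝ) → stdSimplex ℝ κ)
    (σ : stdSimplex ℝ ι × stdSimplex ℝ κ) : Prop :=
  σ.1 = πR (G.rowExpected σ.2) ∧ σ.2 = πC (G.colExpected σ.1)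

end BimatrixGame

/-- The four axioms of a regular quantal response function, which sends a vector of expected
payoffs to a mixed strategy. Responsiveness is stated as strict monotonicity in the own payoff,
which is implied by positivity of the partial derivative of `π u j` in `u j`. -/
structure IsRegularQRF {ι : Type*} [Fintype ι] [DecidableEq ι]
    (π : (ι → ℝ) → stdSimplex ℝ ι) : Prop where
  interiority : ∀ u j, 0 < (π u).1 j
  continuity : Continuous π
  responsiveness : ∀ (u : ι → ℝ) (j : ι) (x : ℝ), u j < x →
    (π u).1 j < (π (Function.update u j x)).1 j
  rank_order : ∀ (u : ι → ℝ) (j k : ι), u k < u j → (π u).1 k < (π u).1 j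

/-- A quantal response function is structural if it comes from additive payoff shocks: there is an
absolutely continuous probability distribution `F` of the shocks, with mean zero and not depending
on the payoffs, such that `π u j` is the probability that `j` maximizes `u k + ε k` over `k`. -/
def IsStructuralQRF {ι : Type*} [Fintype ι] (π : (ι → ℝ) → stdSimplex ℝ ι) : Prop :=
  ∃ F : Measure (ι → ℝ), IsProbabilityMeasure F ∧ F ≪ volume ∧
    (∀ j, Integrable (fun ε : ι → ℝ => ε j) F ∧ ∫ ε, ε j ∂F = 0) ∧
    ∀ (u : ι → ℝ) (j : ι), (π u).1 j = F.real {ε | ∀ k, u k + ε k ≤ u j + ε j}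

/-! The four games. The strategies `1`, `2`, `J` of each player are `0`, `1`, `2 : Fin 3`. -/

/-- Column's payoffs, common to all four games. -/
def jokerCol : Matrix (Fin 3) (Fin 3) ℝ :=
  !![30, 10, 30;
     10, 30, 30;
     30, 30, 10]

/-- Game 1 (Symmetric Joker). -/
def jokerGame1 : BimatrixGame (Fin 3) (Fin 3) where
  row := !![10, 30, 10;
            30, 10, 10;
            10, 10, 30]
  col := jokerCol

/-- Game 2 (Low Joker). -/
def jokerGame2 : BimatrixGame (Fin 3) (Fin 3) where
  row := !![10, 30, 10;
            30, 10, 10;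
            10, 10, 55]
  col := jokerCol

/-- Game 3 (High Joker). -/
def jokerGame3 : BimatrixGame (Fin 3) (Fin 3) where
  row := !![25, 30, 10;
            30, 25, 10;
            10, 10, 30]
  col := jokerCol

/-- Game 4 (Low 2). -/
def jokerGame4 : BimatrixGame (Fin 3) (Fin 3) where
  row := !![20, 30, 10;
            30, 10, 10;
            10, 10, 30]
  col := jokerCol

/-! Regularity makes choice probabilities order strategies exactly as payoffs do (`lt_iff`), so at a
QRE every comparison of one player's probabilities is a linear comparison of the other's. Row tends
to match where Column tends to mismatch: the comparisons form contradictory cycles unless two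
strategies of each player are tied, and what remains yields the bounds.

Existence needs only an interval fixed point: profiles with the right ties are preserved by the
responses and have one parameter per player (`exists_isQRE_of_tied`). Structural responses are
translation invariant, so the odd strategy's probability increases strictly with its payoff
advantage; the two reactions then compose to negative feedback, which excludes a second equilibrium
(`eq_of_tied`). Game 1 needs no shocks, because the order relations already force uniformity. -/

open Filter Topology

/-! ### Order properties of regular responses -/

namespace IsRegularQRF

variable {ι : Type*} [Fintype ι] [DecidableEq ι] {π : (ι → ℝ) → stdSimplex ℝ ι}

/-- Strategies with equal payoffs are ordered weakly, as limits of perturbed payoffs. -/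
theorem le_of_le (h : IsRegularQRF π) {u : ι → ℝ} {j k : ι} (hjk : u k ≤ u j) :
    (π u).1 k ≤ (π u).1 j := by
  rcases eq_or_ne k j with rfl | hne
  · exact le_rfl
  have hcont (i : ι) : Continuous fun x : ℝ => (π (Function.update u j x)).1 i :=
    (continuous_apply i).comp (continuous_subtype_val.comp
      (h.continuity.comp (continuous_const.update j continuous_id)))
  have hlim (i : ι) : Tendsto (fun x : ℝ => (π (Function.update u j x)).1 i) (𝓝[>] (u j))
      (𝓝 ((π u).1 i)) := by
    have := ((hcont i).tendsto (u j)).mono_left (nhdsWithin_le_nhds (s := Ioi (u j)))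
    rwa [Function.update_eq_self] at this
  refine le_of_tendsto_of_tendsto (hlim k) (hlim j) ?_
  filter_upwards [self_mem_nhdsWithin] with x hx
  refine (h.rank_order _ j k ?_).le
  rw [Function.update_of_ne hne, Function.update_self]
  exact hjk.trans_lt hx

theorem lt_iff (h : IsRegularQRF π) (u : ι → ℝ) (j k : ι) :
    (π u).1 j < (π u).1 k ↔ u j < u k :=
  ⟨fun hlt => lt_of_not_ge fun hle => hlt.not_ge (h.le_of_le hle), h.rank_order u k j⟩

theorem eq_of_eq (h : IsRegularQRF π) {u : ι → ℝ} {j k : ι} (hjk : u j = u k) :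
    (π u).1 j = (π u).1 k :=
  (h.le_of_le hjk.le).antisymm (h.le_of_le hjk.ge)

end IsRegularQRF

/-! ### Translation invariance of structural responses -/

namespace IsStructuralQRF

variable {ι : Type*} [Fintype ι] {π : (ι → ℝ) → stdSimplex ℝ ι}

/-- Additive payoff shocks make choice probabilities invariant under payoff translations. -/
theorem apply_add_const (h : IsStructuralQRF π) (u : ι → ℝ) (c : ℝ) :
    π (fun i => u i + c) = π u := by
  obtain ⟨F, -, -, -, hF⟩ := h
  refine Subtype.ext (funext fun j => ?_)
  rw [hF, hF]
  congr 1
  ext ε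
  simp only [mem_ofPred_eq]
  refine forall_congr' fun k => ?_
  constructor <;> intro hk <;> linarith

/-- If all strategies but `k` have equal payoffs, the probability of `k` is strictly increasing in
the payoff advantage of `k`. -/
theorem update_lt_update [DecidableEq ι] (h : IsStructuralQRF π) (hreg : IsRegularQRF π)
    (k : ι) {x y x' y' : ℝ} (hlt : x - y < x' - y') :
    (π (Function.update (fun _ => y) k x)).1 k <
      (π (Function.update (fun _ => y') k x')).1 k := by
  -- Translating the common payoff to 0 leaves one varying coordinate, to which responsiveness
  -- applies.
  have key (x y : ℝ) : π (Function.update (fun _ => y) k x) =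
      π (Function.update (fun _ => 0) k (x - y)) := by
    rw [← h.apply_add_const (Function.update (fun _ => 0) k (x - y)) y]
    congr 1
    ext i
    by_cases hi : i = k <;> simp [hi]
  rw [key x y, key x' y']
  have := hreg.responsiveness (Function.update (fun _ => 0) k (x - y)) k (x' - y') (by simpa)
  rwa [Function.update_idem] at this

end IsStructuralQRF

/-- `p` gives probability `x` to each strategy other than `k`. -/
def IsTiedOff (p : stdSimplex ℝ (Fin 3)) (k : Fin 3) (x : ℝ) : Prop :=
  ∀ i, i ≠ k → p.1 i = x

theorem stdSimplex_fin_three_sum (p : stdSimplex ℝ (Fin 3)) : p.1 0 + p.1 1 + p.1 2 = 1 := by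
  simpa [Fin.sum_univ_three] using p.2.2

theorem IsTiedOff.apply_eq {p : stdSimplex ℝ (Fin 3)} {k : Fin 3} {x : ℝ} (h : IsTiedOff p k x) :
    p.1 k = 1 - 2 * x := by
  have hsum := stdSimplex_fin_three_sum p
  have h0 := h 0
  have h1 := h 1
  have h2 := h 2
  fin_cases k <;> simp at h0 h1 h2 ⊢ <;> linarith

theorem IsRegularQRF.isTiedOff {π : (Fin 3 → ℝ) → stdSimplex ℝ (Fin 3)} (h : IsRegularQRF π)
    (k : Fin 3) (x y : ℝ) :
    IsTiedOff (π (Function.update (fun _ => y) k x)) k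
      ((1 - (π (Function.update (fun _ => y) k x)).1 k) / 2) := by
  have heq (i j : Fin 3) (hi : i ≠ k) (hj : j ≠ k) :=
    h.eq_of_eq (u := Function.update (fun _ => y) k x) (j := i) (k := j) (by simp [hi, hj])
  generalize π (Function.update (fun _ => y) k x) = p at heq ⊢
  have hsum := stdSimplex_fin_three_sum p
  intro i hi
  have h01 := heq 0 1
  have h02 := heq 0 2
  have h12 := heq 1 2
  fin_cases k <;> fin_cases i <;> simp at hi h01 h02 h12 ⊢ <;> linarith

/-! ### One-parameter reduction for tied profiles -/

namespace BimatrixGame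

variable {G : BimatrixGame (Fin 3) (Fin 3)} {πR πC : (Fin 3 → ℝ) → stdSimplex ℝ (Fin 3)}
  {kR kC : Fin 3} {a b c d : ℝ → ℝ}

/-- If each player's best reply problem preserves ties off one strategy, a quantal response
equilibrium is found by a one-dimensional fixed point argument. -/
theorem exists_isQRE_of_tied (hR : IsRegularQRF πR) (hC : IsRegularQRF πC)
    (ha : Continuous a) (hb : Continuous b) (hc : Continuous c) (hd : Continuous d)
    (hrow : ∀ τ t, IsTiedOff τ kC t →
      G.rowExpected τ = Function.update (fun _ => a t) kR (b t))
    (hcol : ∀ σ s, IsTiedOff σ kR s →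
      G.colExpected σ = Function.update (fun _ => c s) kC (d s)) :
    ∃ σ, G.IsQRE πR πC σ := by
  let vR : ℝ → Fin 3 → ℝ := fun t => Function.update (fun _ => a t) kR (b t)
  let vC : ℝ → Fin 3 → ℝ := fun s => Function.update (fun _ => c s) kC (d s)
  let f : ℝ → ℝ := fun t => (1 - (πR (vR t)).1 kR) / 2
  let g : ℝ → ℝ := fun s => (1 - (πC (vC s)).1 kC) / 2
  have hf : Continuous f :=
    (continuous_const.sub ((continuous_apply kR).comp (continuous_subtype_val.comp
      (hR.continuity.comp ((continuous_pi fun _ => ha).update kR hb))))).div_const 2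
  have hg : Continuous g :=
    (continuous_const.sub ((continuous_apply kC).comp (continuous_subtype_val.comp
      (hC.continuity.comp ((continuous_pi fun _ => hc).update kC hd))))).div_const 2
  -- A tied probability is half of what the odd strategy leaves, hence at most 1/2.
  have hmaps : MapsTo (f ∘ g) (Icc 0 (1 / 2)) (Icc 0 (1 / 2)) := by
    intro s _
    have h0 := (πR (vR (g s))).2.1 kR
    have h1 := (mem_Icc_of_mem_stdSimplex (πR (vR (g s))).2 kR).2
    simp only [Function.comp, f, mem_Icc]
    constructor <;> linarith
  obtain ⟨s, -, hs⟩ := exists_mem_Icc_isFixedPt_of_mapsTo (hf.comp hg).continuousOn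
    (by norm_num) hmaps
  refine ⟨(πR (vR (g s)), πC (vC s)), ?_, ?_⟩
  · rw [hrow _ (g s) (hC.isTiedOff kC (d s) (c s))]
  · have h := hR.isTiedOff kR (b (g s)) (a (g s))
    change IsTiedOff (πR (vR (g s))) kR ((f ∘ g) s) at h
    rw [hs] at h
    rw [hcol _ s h]

/-- Tied equilibria are unique if Column's excess payoff from the odd strategy is increasing and
Row's is decreasing in the opponent's tied probability. -/
theorem IsQRE.eq_of_tied (hR : IsRegularQRF πR) (hC : IsRegularQRF πC)
    (hRs : IsStructuralQRF πR) (hCs : IsStructuralQRF πC)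
    (hrow : ∀ τ t, IsTiedOff τ kC t →
      G.rowExpected τ = Function.update (fun _ => a t) kR (b t))
    (hcol : ∀ σ s, IsTiedOff σ kR s →
      G.colExpected σ = Function.update (fun _ => c s) kC (d s))
    (hab : ∀ t t', t' < t → b t - a t < b t' - a t')
    (hcd : ∀ s s', s < s' → d s - c s < d s' - c s')
    {σ σ' : stdSimplex ℝ (Fin 3) × stdSimplex ℝ (Fin 3)}
    (hσ : G.IsQRE πR πC σ) (hσ' : G.IsQRE πR πC σ') {s t s' t' : ℝ}
    (hs : IsTiedOff σ.1 kR s) (ht : IsTiedOff σ.2 kC t)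
    (hs' : IsTiedOff σ'.1 kR s') (ht' : IsTiedOff σ'.2 kC t') : σ = σ' := by
  have hnot {σ σ' : stdSimplex ℝ (Fin 3) × stdSimplex ℝ (Fin 3)}
      (hσ : G.IsQRE πR πC σ) (hσ' : G.IsQRE πR πC σ') {s t s' t' : ℝ}
      (hs : IsTiedOff σ.1 kR s) (ht : IsTiedOff σ.2 kC t)
      (hs' : IsTiedOff σ'.1 kR s') (ht' : IsTiedOff σ'.2 kC t') : ¬ s < s' := by
    intro hlt
    -- A larger `s` raises Column's odd probability, so lowers `t`; this raises Row's odd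
    -- probability, so lowers `s`.
    have h1 := hCs.update_lt_update hC kC (hcd s s' hlt)
    rw [← hcol _ s hs, ← hcol _ s' hs', ← hσ.2, ← hσ'.2, ht.apply_eq, ht'.apply_eq] at h1
    have h2 := hRs.update_lt_update hR kR (hab t t' (by linarith))
    rw [← hrow _ t ht, ← hrow _ t' ht', ← hσ.1, ← hσ'.1, hs.apply_eq, hs'.apply_eq] at h2
    linarith
  obtain rfl : s = s' := le_antisymm (not_lt.1 (hnot hσ' hσ hs' ht' hs ht))
    (not_lt.1 (hnot hσ hσ' hs ht hs' ht'))
  have h2 : σ.2 = σ'.2 := by rw [hσ.2, hσ'.2, hcol _ s hs, hcol _ s hs']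
  exact Prod.ext (by rw [hσ.1, hσ'.1, h2]) h2

theorem IsQRE.row_lt_iff (hR : IsRegularQRF πR)
    {σ : stdSimplex ℝ (Fin 3) × stdSimplex ℝ (Fin 3)} (hσ : G.IsQRE πR πC σ) (i j : Fin 3) :
    σ.1.1 i < σ.1.1 j ↔ G.rowExpected σ.2 i < G.rowExpected σ.2 j := by
  rw [hσ.1]
  exact hR.lt_iff _ i j

theorem IsQRE.col_lt_iff (hC : IsRegularQRF πC)
    {σ : stdSimplex ℝ (Fin 3) × stdSimplex ℝ (Fin 3)} (hσ : G.IsQRE πR πC σ) (i j : Fin 3) :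
    σ.2.1 i < σ.2.1 j ↔ G.colExpected σ.1 i < G.colExpected σ.1 j := by
  rw [hσ.2]
  exact hC.lt_iff _ i j

end BimatrixGame

/-! ### Order relations and bounds in the four games -/

section Joker

variable {πR πC : (Fin 3 → ℝ) → stdSimplex ℝ (Fin 3)}

/-- Each column loses 20 against exactly one row, with 1 and 2 interchanged; hence the permuted
indices and reversed orders below. -/
theorem colExpected_of_col_eq_jokerCol {G : BimatrixGame (Fin 3) (Fin 3)} (hG : G.col = jokerCol)
    (σ : stdSimplex ℝ (Fin 3)) :
    G.colExpected σ = ![30 - 20 * σ.1 1, 30 - 20 * σ.1 0, 30 - 20 * σ.1 2] := by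
  have hsum := stdSimplex_fin_three_sum σ
  ext j
  fin_cases j <;> simp [BimatrixGame.colExpected, hG, jokerCol, Fin.sum_univ_three] <;> linarith

theorem BimatrixGame.IsQRE.joker_col_lt_iff {G : BimatrixGame (Fin 3) (Fin 3)}
    (hG : G.col = jokerCol) (hC : IsRegularQRF πC)
    {σ : stdSimplex ℝ (Fin 3) × stdSimplex ℝ (Fin 3)} (hσ : G.IsQRE πR πC σ) :
    (σ.2.1 0 < σ.2.1 1 ↔ σ.1.1 0 < σ.1.1 1) ∧ (σ.2.1 1 < σ.2.1 0 ↔ σ.1.1 1 < σ.1.1 0) ∧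
    (σ.2.1 0 < σ.2.1 2 ↔ σ.1.1 2 < σ.1.1 1) ∧ (σ.2.1 2 < σ.2.1 0 ↔ σ.1.1 1 < σ.1.1 2) ∧
    (σ.2.1 1 < σ.2.1 2 ↔ σ.1.1 2 < σ.1.1 0) ∧ (σ.2.1 2 < σ.2.1 1 ↔ σ.1.1 0 < σ.1.1 2) := by
  have key := hσ.col_lt_iff hC
  rw [colExpected_of_col_eq_jokerCol hG] at key
  have h01 := key 0 1
  have h10 := key 1 0
  have h02 := key 0 2
  have h20 := key 2 0
  have h12 := key 1 2
  have h21 := key 2 1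
  simp at h01 h10 h02 h20 h12 h21
  exact ⟨h01, h10, h02, h20, h12, h21⟩

theorem jokerGame1_rowExpected (τ : stdSimplex ℝ (Fin 3)) :
    jokerGame1.rowExpected τ =
      ![10 + 20 * τ.1 1, 10 + 20 * τ.1 0, 10 + 20 * τ.1 2] := by
  have hsum := stdSimplex_fin_three_sum τ
  ext i
  fin_cases i <;> simp [BimatrixGame.rowExpected, jokerGame1, Fin.sum_univ_three] <;> linarith

theorem jokerGame2_rowExpected (τ : stdSimplex ℝ (Fin 3)) :
    jokerGame2.rowExpected τ =
      ![10 + 20 * τ.1 1, 10 + 20 * τ.1 0, 10 + 45 * τ.1 2] := by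
  have hsum := stdSimplex_fin_three_sum τ
  ext i
  fin_cases i <;> simp [BimatrixGame.rowExpected, jokerGame2, Fin.sum_univ_three] <;> linarith

theorem jokerGame3_rowExpected (τ : stdSimplex ℝ (Fin 3)) :
    jokerGame3.rowExpected τ =
      ![10 + 15 * τ.1 0 + 20 * τ.1 1, 10 + 20 * τ.1 0 + 15 * τ.1 1, 10 + 20 * τ.1 2] := by
  have hsum := stdSimplex_fin_three_sum τ
  ext i
  fin_cases i <;> simp [BimatrixGame.rowExpected, jokerGame3, Fin.sum_univ_three] <;> linarith

theorem jokerGame4_rowExpected (τ : stdSimplex ℝ (Fin 3)) :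
    jokerGame4.rowExpected τ =
      ![10 + 10 * τ.1 0 + 20 * τ.1 1, 10 + 20 * τ.1 0, 10 + 20 * τ.1 2] := by
  have hsum := stdSimplex_fin_three_sum τ
  ext i
  fin_cases i <;> simp [BimatrixGame.rowExpected, jokerGame4, Fin.sum_univ_three] <;> linarith

theorem BimatrixGame.IsQRE.jokerGame1_eq_uniform (hR : IsRegularQRF πR) (hC : IsRegularQRF πC)
    {σ : stdSimplex ℝ (Fin 3) × stdSimplex ℝ (Fin 3)} (hσ : jokerGame1.IsQRE πR πC σ) :
    (∀ i, σ.1.1 i = 1 / 3) ∧ (∀ j, σ.2.1 j = 1 / 3) := by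
  obtain ⟨c01, c10, c02, c20, c12, c21⟩ := hσ.joker_col_lt_iff rfl hC
  have key := hσ.row_lt_iff hR
  rw [jokerGame1_rowExpected] at key
  have r01 := key 0 1
  have r10 := key 1 0
  have r02 := key 0 2
  have r20 := key 2 0
  have r12 := key 1 2
  have r21 := key 2 1
  have hpR (i : Fin 3) : 0 < σ.1.1 i := by rw [hσ.1]; exact hR.interiority _ i
  have hpC (i : Fin 3) : 0 < σ.2.1 i := by rw [hσ.2]; exact hC.interiority _ i
  have p0 := hpR 0
  have p1 := hpR 1
  have p2 := hpR 2
  have q0 := hpC 0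
  have q1 := hpC 1
  have q2 := hpC 2
  have hp := stdSimplex_fin_three_sum σ.1
  have hq := stdSimplex_fin_three_sum σ.2
  clear key hpR hpC hσ
  simp at r01 r10 r02 r20 r12 r21
  refine ⟨fun i => ?_, fun j => ?_⟩
  · fin_cases i <;> simp <;> grind
  · fin_cases j <;> simp <;> grind

/-- A strict gap between strategies 1 and 2 would be reversed after one round of responses. Row must
favour `J`, so `45 * (1 - 2 * t) > 20 * t` for Column's tied probability `t`; equality is at 9/22.
-/
theorem BimatrixGame.IsQRE.jokerGame2_bounds (hR : IsRegularQRF πR) (hC : IsRegularQRF πC)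
    {σ : stdSimplex ℝ (Fin 3) × stdSimplex ℝ (Fin 3)} (hσ : jokerGame2.IsQRE πR πC σ) :
    (σ.1.1 0 = σ.1.1 1 ∧ σ.1.1 0 ∈ Ioo (0 : ℝ) (1 / 3)) ∧
      (σ.2.1 0 = σ.2.1 1 ∧ σ.2.1 0 ∈ Ioc (1 / 3 : ℝ) (9 / 22)) := by
  obtain ⟨c01, c10, c02, c20, c12, c21⟩ := hσ.joker_col_lt_iff rfl hC
  have key := hσ.row_lt_iff hR
  rw [jokerGame2_rowExpected] at key
  have r01 := key 0 1
  have r10 := key 1 0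
  have r02 := key 0 2
  have r20 := key 2 0
  have r12 := key 1 2
  have r21 := key 2 1
  have hpR (i : Fin 3) : 0 < σ.1.1 i := by rw [hσ.1]; exact hR.interiority _ i
  have hpC (i : Fin 3) : 0 < σ.2.1 i := by rw [hσ.2]; exact hC.interiority _ i
  have p0 := hpR 0
  have p1 := hpR 1
  have p2 := hpR 2
  have q0 := hpC 0
  have q1 := hpC 1
  have q2 := hpC 2
  have hp := stdSimplex_fin_three_sum σ.1
  have hq := stdSimplex_fin_three_sum σ.2
  clear key hpR hpC hσ
  simp at r01 r10 r02 r20 r12 r21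
  simp only [mem_Ioo, mem_Ioc]
  refine ⟨⟨?_, ?_, ?_⟩, ?_, ?_, ?_⟩ <;> grind

/-- Here Row disfavours `J`, so `35 * t > 20 * (1 - 2 * t)`; equality is at 4/15. -/
theorem BimatrixGame.IsQRE.jokerGame3_bounds (hR : IsRegularQRF πR) (hC : IsRegularQRF πC)
    {σ : stdSimplex ℝ (Fin 3) × stdSimplex ℝ (Fin 3)} (hσ : jokerGame3.IsQRE πR πC σ) :
    (σ.1.1 0 = σ.1.1 1 ∧ σ.1.1 0 ∈ Ioo (1 / 3 : ℝ) 1) ∧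
      (σ.2.1 0 = σ.2.1 1 ∧ σ.2.1 0 ∈ Ico (4 / 15 : ℝ) (1 / 3)) := by
  obtain ⟨c01, c10, c02, c20, c12, c21⟩ := hσ.joker_col_lt_iff rfl hC
  have key := hσ.row_lt_iff hR
  rw [jokerGame3_rowExpected] at key
  have r01 := key 0 1
  have r10 := key 1 0
  have r02 := key 0 2
  have r20 := key 2 0
  have r12 := key 1 2
  have r21 := key 2 1
  have hpR (i : Fin 3) : 0 < σ.1.1 i := by rw [hσ.1]; exact hR.interiority _ i
  have hpC (i : Fin 3) : 0 < σ.2.1 i := by rw [hσ.2]; exact hC.interiority _ i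
  have p0 := hpR 0
  have p1 := hpR 1
  have p2 := hpR 2
  have q0 := hpC 0
  have q1 := hpC 1
  have q2 := hpC 2
  have hp := stdSimplex_fin_three_sum σ.1
  have hq := stdSimplex_fin_three_sum σ.2
  clear key hpR hpC hσ
  simp at r01 r10 r02 r20 r12 r21
  simp only [mem_Ioo, mem_Ico]
  refine ⟨⟨?_, ?_, ?_⟩, ?_, ?_, ?_⟩ <;> grind

/-- Row's odd strategy is now 1, and Column's is 2 by the interchange. Row favours 1, so `20 - 30 *
t > 20 * t`; equality is at 2/5. -/
theorem BimatrixGame.IsQRE.jokerGame4_bounds (hR : IsRegularQRF πR) (hC : IsRegularQRF πC)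
    {σ : stdSimplex ℝ (Fin 3) × stdSimplex ℝ (Fin 3)} (hσ : jokerGame4.IsQRE πR πC σ) :
    (σ.1.1 1 = σ.1.1 2 ∧ σ.1.1 1 ∈ Ioo (0 : ℝ) (1 / 3)) ∧
      (σ.2.1 0 = σ.2.1 2 ∧ σ.2.1 0 ∈ Ioc (1 / 3 : ℝ) (2 / 5)) := by
  obtain ⟨c01, c10, c02, c20, c12, c21⟩ := hσ.joker_col_lt_iff rfl hC
  have key := hσ.row_lt_iff hR
  rw [jokerGame4_rowExpected] at key
  have r01 := key 0 1
  have r10 := key 1 0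
  have r02 := key 0 2
  have r20 := key 2 0
  have r12 := key 1 2
  have r21 := key 2 1
  have hpR (i : Fin 3) : 0 < σ.1.1 i := by rw [hσ.1]; exact hR.interiority _ i
  have hpC (i : Fin 3) : 0 < σ.2.1 i := by rw [hσ.2]; exact hC.interiority _ i
  have p0 := hpR 0
  have p1 := hpR 1
  have p2 := hpR 2
  have q0 := hpC 0
  have q1 := hpC 1
  have q2 := hpC 2
  have hp := stdSimplex_fin_three_sum σ.1
  have hq := stdSimplex_fin_three_sum σ.2
  clear key hpR hpC hσ
  simp at r01 r10 r02 r20 r12 r21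
  simp only [mem_Ioo, mem_Ioc]
  refine ⟨⟨?_, ?_, ?_⟩, ?_, ?_, ?_⟩ <;> grind

/-! ### Payoffs at tied profiles, existence and uniqueness -/

theorem jokerGame1_rowExpected_of_tied (τ : stdSimplex ℝ (Fin 3)) (t : ℝ)
    (h : IsTiedOff τ 2 t) : jokerGame1.rowExpected τ =
      Function.update (fun _ => 10 + 20 * t) 2 (10 + 20 * (1 - 2 * t)) := by
  have hk := h.apply_eq
  rw [jokerGame1_rowExpected, h 0 (by decide), h 1 (by decide), hk]
  ext i
  fin_cases i <;> simp

theorem jokerGame2_rowExpected_of_tied (τ : stdSimplex ℝ (Fin 3)) (t : ℝ)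
    (h : IsTiedOff τ 2 t) : jokerGame2.rowExpected τ =
      Function.update (fun _ => 10 + 20 * t) 2 (10 + 45 * (1 - 2 * t)) := by
  have hk := h.apply_eq
  rw [jokerGame2_rowExpected, h 0 (by decide), h 1 (by decide), hk]
  ext i
  fin_cases i <;> simp

theorem jokerGame3_rowExpected_of_tied (τ : stdSimplex ℝ (Fin 3)) (t : ℝ)
    (h : IsTiedOff τ 2 t) : jokerGame3.rowExpected τ =
      Function.update (fun _ => 10 + 35 * t) 2 (10 + 20 * (1 - 2 * t)) := by
  have hk := h.apply_eq
  rw [jokerGame3_rowExpected, h 0 (by decide), h 1 (by decide), hk]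
  ext i
  fin_cases i <;> simp <;> ring

theorem jokerGame4_rowExpected_of_tied (τ : stdSimplex ℝ (Fin 3)) (t : ℝ)
    (h : IsTiedOff τ 1 t) : jokerGame4.rowExpected τ =
      Function.update (fun _ => 10 + 20 * t) 0 (10 + 10 * t + 20 * (1 - 2 * t)) := by
  have hk := h.apply_eq
  rw [jokerGame4_rowExpected, h 0 (by decide), h 2 (by decide), hk]
  ext i
  fin_cases i <;> simp

theorem joker_colExpected_of_tied_2 {G : BimatrixGame (Fin 3) (Fin 3)}
    (hG : G.col = jokerCol) (σ : stdSimplex ℝ (Fin 3)) (s : ℝ) (h : IsTiedOff σ 2 s) :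
    G.colExpected σ =
      Function.update (fun _ => 30 - 20 * s) 2 (30 - 20 * (1 - 2 * s)) := by
  have hk := h.apply_eq
  rw [colExpected_of_col_eq_jokerCol hG, h 1 (by decide), h 0 (by decide), hk]
  ext i
  fin_cases i <;> simp

theorem joker_colExpected_of_tied_0 {G : BimatrixGame (Fin 3) (Fin 3)}
    (hG : G.col = jokerCol) (σ : stdSimplex ℝ (Fin 3)) (s : ℝ) (h : IsTiedOff σ 0 s) :
    G.colExpected σ =
      Function.update (fun _ => 30 - 20 * s) 1 (30 - 20 * (1 - 2 * s)) := by
  have hk := h.apply_eq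
  rw [colExpected_of_col_eq_jokerCol hG, h 1 (by decide), h 2 (by decide), hk]
  ext i
  fin_cases i <;> simp

theorem exists_isQRE_jokerGame1 (hR : IsRegularQRF πR) (hC : IsRegularQRF πC) :
    ∃ σ, jokerGame1.IsQRE πR πC σ :=
  BimatrixGame.exists_isQRE_of_tied hR hC (by fun_prop) (by fun_prop) (by fun_prop) (by fun_prop)
    jokerGame1_rowExpected_of_tied (joker_colExpected_of_tied_2 rfl)

theorem exists_isQRE_jokerGame2 (hR : IsRegularQRF πR) (hC : IsRegularQRF πC) :
    ∃ σ, jokerGame2.IsQRE πR πC σ :=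
  BimatrixGame.exists_isQRE_of_tied hR hC (by fun_prop) (by fun_prop) (by fun_prop) (by fun_prop)
    jokerGame2_rowExpected_of_tied (joker_colExpected_of_tied_2 rfl)

theorem exists_isQRE_jokerGame3 (hR : IsRegularQRF πR) (hC : IsRegularQRF πC) :
    ∃ σ, jokerGame3.IsQRE πR πC σ :=
  BimatrixGame.exists_isQRE_of_tied hR hC (by fun_prop) (by fun_prop) (by fun_prop) (by fun_prop)
    jokerGame3_rowExpected_of_tied (joker_colExpected_of_tied_2 rfl)

theorem exists_isQRE_jokerGame4 (hR : IsRegularQRF πR) (hC : IsRegularQRF πC) :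
    ∃ σ, jokerGame4.IsQRE πR πC σ :=
  BimatrixGame.exists_isQRE_of_tied hR hC (by fun_prop) (by fun_prop) (by fun_prop) (by fun_prop)
    jokerGame4_rowExpected_of_tied (joker_colExpected_of_tied_0 rfl)

theorem BimatrixGame.IsQRE.jokerGame2_unique (hR : IsRegularQRF πR) (hC : IsRegularQRF πC)
    (hRs : IsStructuralQRF πR) (hCs : IsStructuralQRF πC)
    {σ σ' : stdSimplex ℝ (Fin 3) × stdSimplex ℝ (Fin 3)} (hσ : jokerGame2.IsQRE πR πC σ)
    (hσ' : jokerGame2.IsQRE πR πC σ') : σ = σ' := by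
  obtain ⟨⟨h1, -⟩, h2, -⟩ := hσ.jokerGame2_bounds hR hC
  obtain ⟨⟨h1', -⟩, h2', -⟩ := hσ'.jokerGame2_bounds hR hC
  refine hσ.eq_of_tied hR hC hRs hCs jokerGame2_rowExpected_of_tied
    (joker_colExpected_of_tied_2 rfl) (fun t t' h => by linarith) (fun s s' h => by linarith) hσ'
    (s := σ.1.1 0) (t := σ.2.1 0) (s' := σ'.1.1 0) (t' := σ'.2.1 0)
    ?_ ?_ ?_ ?_ <;> intro i hi <;> fin_cases i <;> simp_all

theorem BimatrixGame.IsQRE.jokerGame3_unique (hR : IsRegularQRF πR) (hC : IsRegularQRF πC)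
    (hRs : IsStructuralQRF πR) (hCs : IsStructuralQRF πC)
    {σ σ' : stdSimplex ℝ (Fin 3) × stdSimplex ℝ (Fin 3)} (hσ : jokerGame3.IsQRE πR πC σ)
    (hσ' : jokerGame3.IsQRE πR πC σ') : σ = σ' := by
  obtain ⟨⟨h1, -⟩, h2, -⟩ := hσ.jokerGame3_bounds hR hC
  obtain ⟨⟨h1', -⟩, h2', -⟩ := hσ'.jokerGame3_bounds hR hC
  refine hσ.eq_of_tied hR hC hRs hCs jokerGame3_rowExpected_of_tied
    (joker_colExpected_of_tied_2 rfl) (fun t t' h => by linarith) (fun s s' h => by linarith) hσ'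
    (s := σ.1.1 0) (t := σ.2.1 0) (s' := σ'.1.1 0) (t' := σ'.2.1 0)
    ?_ ?_ ?_ ?_ <;> intro i hi <;> fin_cases i <;> simp_all

theorem BimatrixGame.IsQRE.jokerGame4_unique (hR : IsRegularQRF πR) (hC : IsRegularQRF πC)
    (hRs : IsStructuralQRF πR) (hCs : IsStructuralQRF πC)
    {σ σ' : stdSimplex ℝ (Fin 3) × stdSimplex ℝ (Fin 3)} (hσ : jokerGame4.IsQRE πR πC σ)
    (hσ' : jokerGame4.IsQRE πR πC σ') : σ = σ' := by
  obtain ⟨⟨h1, -⟩, h2, -⟩ := hσ.jokerGame4_bounds hR hC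
  obtain ⟨⟨h1', -⟩, h2', -⟩ := hσ'.jokerGame4_bounds hR hC
  refine hσ.eq_of_tied hR hC hRs hCs jokerGame4_rowExpected_of_tied
    (joker_colExpected_of_tied_0 rfl) (fun t t' h => by linarith) (fun s s' h => by linarith) hσ'
    (s := σ.1.1 1) (t := σ.2.1 0) (s' := σ'.1.1 1) (t' := σ'.2.1 0)
    ?_ ?_ ?_ ?_ <;> intro i hi <;> fin_cases i <;> simp_all

end Joker

theorem proposition3
    (πR πC : (Fin 3 → ℝ) → stdSimplex ℝ (Fin 3))
    (hR : IsRegularQRF πR) (hC : IsRegularQRF πC) :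
    -- each game has a quantal response equilibrium
    (∀ G ∈ ({jokerGame1, jokerGame2, jokerGame3, jokerGame4} :
        Set (BimatrixGame (Fin 3) (Fin 3))), ∃ σ, G.IsQRE πR πC σ) ∧
    -- and only one, if the response functions are derived from additive payoff shocks
    (IsStructuralQRF πR → IsStructuralQRF πC →
      ∀ G ∈ ({jokerGame1, jokerGame2, jokerGame3, jokerGame4} :
        Set (BimatrixGame (Fin 3) (Fin 3))), ∃! σ, G.IsQRE πR πC σ) ∧
    -- in Game 1 the uniform profile is the one and only equilibrium (no shocks needed)
    (∀ σ, jokerGame1.IsQRE πR πC σ ↔ (∀ i, σ.1.1 i = 1 / 3) ∧ (∀ j, σ.2.1 j = 1 / 3)) ∧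
    -- Game 2
    (∀ σ, jokerGame2.IsQRE πR πC σ →
      (σ.1.1 0 = σ.1.1 1 ∧ σ.1.1 0 ∈ Ioo (0 : ℝ) (1 / 3)) ∧
      (σ.2.1 0 = σ.2.1 1 ∧ σ.2.1 0 ∈ Ioc (1 / 3 : ℝ) (9 / 22))) ∧
    -- Game 3
    (∀ σ, jokerGame3.IsQRE πR πC σ →
      (σ.1.1 0 = σ.1.1 1 ∧ σ.1.1 0 ∈ Ioo (1 / 3 : ℝ) 1) ∧
      (σ.2.1 0 = σ.2.1 1 ∧ σ.2.1 0 ∈ Ico (4 / 15 : ℝ) (1 / 3))) ∧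
    -- Game 4
    (∀ σ, jokerGame4.IsQRE πR πC σ →
      (σ.1.1 1 = σ.1.1 2 ∧ σ.1.1 1 ∈ Ioo (0 : ℝ) (1 / 3)) ∧
      (σ.2.1 0 = σ.2.1 2 ∧ σ.2.1 0 ∈ Ioc (1 / 3 : ℝ) (2 / 5))) := by

  have game1 {σ} (hσ : jokerGame1.IsQRE πR πC σ) := hσ.jokerGame1_eq_uniform hR hC
  have unique1 {σ σ'} (hσ : jokerGame1.IsQRE πR πC σ) (hσ' : jokerGame1.IsQRE πR πC σ') :
      σ = σ' :=
    Prod.ext (Subtype.ext (funext fun i => by rw [(game1 hσ).1, (game1 hσ').1]))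
      (Subtype.ext (funext fun j => by rw [(game1 hσ).2, (game1 hσ').2]))
  obtain ⟨σ₁, h₁⟩ := exists_isQRE_jokerGame1 hR hC
  obtain ⟨σ₂, h₂⟩ := exists_isQRE_jokerGame2 hR hC
  obtain ⟨σ₃, h₃⟩ := exists_isQRE_jokerGame3 hR hC
  obtain ⟨σ₄, h₄⟩ := exists_isQRE_jokerGame4 hR hC
  refine ⟨?_, fun hRs hCs => ?_, fun σ => ⟨game1, fun hσ => ?_⟩, fun σ h => h.jokerGame2_bounds hR hC,
    fun σ h => h.jokerGame3_bounds hR hC, fun σ h => h.jokerGame4_bounds hR hC⟩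
  · rintro G (rfl | rfl | rfl | rfl)
    exacts [⟨σ₁, h₁⟩, ⟨σ₂, h₂⟩, ⟨σ₃, h₃⟩, ⟨σ₄, h₄⟩]
  · rintro G (rfl | rfl | rfl | rfl)
    · exact ⟨σ₁, h₁, fun σ h => unique1 h h₁⟩
    · exact ⟨σ₂, h₂, fun σ h => h.jokerGame2_unique hR hC hRs hCs h₂⟩
    · exact ⟨σ₃, h₃, fun σ h => h.jokerGame3_unique hR hC hRs hCs h₃⟩
    · exact ⟨σ₄, h₄, fun σ h => h.jokerGame4_unique hR hC hRs hCs h₄⟩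
  · have : σ = σ₁ := Prod.ext
      (Subtype.ext (funext fun i => by rw [hσ.1, (game1 h₁).1]))
      (Subtype.ext (funext fun j => by rw [hσ.2, (game1 h₁).2]))
    rwa [this]
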